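/- Graphs are undirected, finite or infinite, without loops or multiple edges. A graph is $3$-connected if it has more than three vertices and deleting any set of fewer than three vertices leaves a connected graph. A circuit is a (finite) cycle, identified with its set of edges. Let $G$ be a $3$-connected graph, let $G'$ be a graph without isolated vertices, and let $f : E(G) \to E(G')$ be a one-to-one map from the edges of $G$ onto the edges of $G'$ such that $f(C)$ is a circuit of $G'$ whenever $C$ is a circuit of $G$. Then $f$ is induced by a vertex isomorphism: there is a graph isomorphism $\varphi : V(G) \to V(G')$ such that $f(uv) = \varphi(u)\varphi(v)$ for every edge $uv$ of $G$. -/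

import Mathlib

namespace CircuitInjection

/-- `G` is `k`-connected: it has more than `k` vertices, and deleting any set of fewer than `k`
vertices leaves a connected graph. The graph may be infinite. -/
def IsKConnected {V : Type*} (G : SimpleGraph V) (k : ℕ) : Prop :=
  (k : ℕ∞) < ENat.card V ∧ ∀ S : Set V, S.encard < (k : ℕ∞) → (G.induce Sᶜ).Connected

/-- A set `C` of edges of `G` is (the edge set of) a circuit: it consists of the edges traversed by
a closed walk of positive length that repeats no edge, and no vertex other than its endpoint
(`SimpleGraph.Walk.IsCycle`). Circuits are finite. -/
def IsCircuit {V : Type*} (G : SimpleGraph V) (C : Set G.edgeSet) : Prop :=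
  ∃ (v : V) (p : G.Walk v v), p.IsCycle ∧ ∀ e : G.edgeSet, e ∈ C ↔ (e : Sym2 V) ∈ p.edges

/-- A circuit injection: a one-to-one edge map which sends every circuit to a circuit. -/
def IsCircuitInjection {V W : Type*} (G : SimpleGraph V) (H : SimpleGraph W)
    (f : G.edgeSet → H.edgeSet) : Prop :=
  Function.Injective f ∧ ∀ C : Set G.edgeSet, IsCircuit G C → IsCircuit H (f '' C)

/-- The edge map `f` is induced by a vertex isomorphism `φ` from `G` to `H`: it sends every edge
`uv` to the edge `φ(u)φ(v)`. -/
def IsInducedByVertexIso {V W : Type*} (G : SimpleGraph V) (H : SimpleGraph W)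
    (f : G.edgeSet → H.edgeSet) : Prop :=
  ∃ φ : G ≃g H, ∀ e : G.edgeSet, (f e : Sym2 W) = Sym2.map φ (e : Sym2 V)

end CircuitInjection

/-! A circuit of `G'` uses zero or two edges at a vertex `w`, so the set `D` of edges of `G` that
`f` sends into the star of `w` meets every circuit of `G` in zero or two edges. In a 3-connected
graph a nonempty `D` of this kind is the edge boundary of a set `X` with both sides connected
(`IsThinCut.exists_bond`), and it has at most three edges once both sides have two vertices
(`IsThinBond.not_four_edges`).

The heart is that `D` is a vertex star (`subsingleton_side`). Otherwise some circuit crosses between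
`X` and `Xᶜ` along two disjoint edges. Its image with `w` removed is a path carrying images of edges
from inside both sides, so two such images share a vertex `z`. The preimage of the star of `z` then
has an edge inside each side of `X`. Each of these lies on a circuit within its side, which supplies
a second edge there. This cut has four edges, two of them disjoint, which is impossible.

Sending `w` to the centre of its preimage star gives the inverse of the required isomorphism.
Surjectivity of `f` and the absence of isolated vertices make each of these stars nonempty. -/

namespace CircuitInjection

open SimpleGraph

variable {V W : Type*} {G : SimpleGraph V} {G' : SimpleGraph W}

/-! ### Connectivity inside a vertex set. -/

/-- `a` and `b` are joined by a walk of `G` all of whose vertices lie in `U`. -/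
def ReachableIn (G : SimpleGraph V) (U : Set V) (a b : V) : Prop :=
  ∃ p : G.Walk a b, ∀ x ∈ p.support, x ∈ U

/-- The set `U` spans a (possibly empty) connected subgraph of `G`. -/
def PreconnectedIn (G : SimpleGraph V) (U : Set V) : Prop :=
  ∀ a ∈ U, ∀ b ∈ U, ReachableIn G U a b

namespace ReachableIn

variable {U U' : Set V} {a b c : V}

theorem refl (ha : a ∈ U) : ReachableIn G U a a := ⟨.nil, by simpa using ha⟩

theorem symm (h : ReachableIn G U a b) : ReachableIn G U b a := by
  obtain ⟨p, hp⟩ := h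
  exact ⟨p.reverse, by simpa using hp⟩

theorem trans (h : ReachableIn G U a b) (h' : ReachableIn G U b c) : ReachableIn G U a c := by
  obtain ⟨p, hp⟩ := h
  obtain ⟨q, hq⟩ := h'
  refine ⟨p.append q, fun x hx => ?_⟩
  rw [Walk.mem_support_append_iff] at hx
  exact hx.elim (hp x) (hq x)

theorem mono (hU : U ⊆ U') (h : ReachableIn G U a b) : ReachableIn G U' a b := by
  obtain ⟨p, hp⟩ := h
  exact ⟨p, fun x hx => hU (hp x hx)⟩

theorem left_mem (h : ReachableIn G U a b) : a ∈ U := by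
  obtain ⟨p, hp⟩ := h
  exact hp _ p.start_mem_support

theorem right_mem (h : ReachableIn G U a b) : b ∈ U := h.symm.left_mem

theorem of_adj (h : G.Adj a b) (ha : a ∈ U) (hb : b ∈ U) : ReachableIn G U a b :=
  ⟨h.toWalk, by simp [ha, hb]⟩

theorem exists_isPath (h : ReachableIn G U a b) :
    ∃ p : G.Walk a b, p.IsPath ∧ ∀ x ∈ p.support, x ∈ U := by
  classical
  obtain ⟨p, hp⟩ := h
  exact ⟨p.bypass, p.bypass_isPath, fun x hx => hp x (p.support_bypass_subset_support hx)⟩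

/-- A set containing `a` and closed under adjacency within `U` contains everything that is
joined to `a` within `U`. -/
theorem mem_of_closed (h : ReachableIn G U a b) {T : Set V} (ha : a ∈ T)
    (hT : ∀ t ∈ T, ∀ t' ∈ U, G.Adj t t' → t' ∈ T) : b ∈ T := by
  obtain ⟨p, hp⟩ := h
  induction p with
  | nil => exact ha
  | cons hadj q ih =>
    refine ih (hT _ ha _ (hp _ (by simp)) hadj) fun x hx => hp x (by simp [hx])

end ReachableIn

theorem preconnectedIn_support {a b : V} (p : G.Walk a b) :
    PreconnectedIn G {x | x ∈ p.support} := by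
  classical
  have key : ∀ x ∈ p.support, ReachableIn G {x | x ∈ p.support} a x := fun x hx =>
    ⟨p.takeUntil x hx, fun y hy => p.support_takeUntil_subset_support hx hy⟩
  exact fun x hx y hy => (key x hx).symm.trans (key y hy)

/-! ### Menger's theorem for two paths. -/

/-- There are two disjoint walks from `A` to `B` within `U`. -/
def HasDisjointWalks (G : SimpleGraph V) (U A B : Set V) : Prop :=
  ∃ a₁ ∈ A, ∃ b₁ ∈ B, ∃ a₂ ∈ A, ∃ b₂ ∈ B, ∃ (p : G.Walk a₁ b₁) (q : G.Walk a₂ b₂),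
    (∀ x ∈ p.support, x ∈ U) ∧ (∀ x ∈ q.support, x ∈ U) ∧ ∀ x ∈ p.support, x ∉ q.support

theorem exists_walk_to_first_hit {a b : V} (p : G.Walk a b) (S : Set V) :
    (∀ x ∈ p.support, x ∉ S) ∨ ∃ z ∈ S, ∃ r : G.Walk a z,
      (∀ x ∈ r.support, x ∈ p.support) ∧ ∀ x ∈ r.support, x ∈ S → x = z := by
  induction p with
  | @nil u =>
    by_cases h : u ∈ S
    · exact Or.inr ⟨u, h, .nil, by simp⟩
    · exact Or.inl (by simpa using h)
  | @cons u v w hadj q ih =>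
    by_cases h : u ∈ S
    · exact Or.inr ⟨u, h, .nil, by simp⟩
    rcases ih with ih | ⟨z, hz, r, hr, hr'⟩
    · refine Or.inl fun x hx => ?_
      rw [Walk.support_cons, List.mem_cons] at hx
      rcases hx with rfl | hx
      exacts [h, ih x hx]
    · refine Or.inr ⟨z, hz, .cons hadj r, fun x hx => ?_, fun x hx hxS => ?_⟩
      · rw [Walk.support_cons, List.mem_cons] at hx ⊢
        exact hx.imp_right (hr x)
      · rw [Walk.support_cons, List.mem_cons] at hx
        rcases hx with rfl | hx
        exacts [absurd hxS h, hr' x hx hxS]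

/-- The augmentation step: `p` stops at a neighbour `t` of `b`. Only the case where `q` runs through
`b` is hard. Then `q` is cut at `b`, and a walk from `A` to `B` avoiding `b` is followed backwards
from `B` to its first vertex `z` on `p` or the shortened `q`. The walk containing `z` is rerouted
there, and the other one ends at `b`. -/
theorem HasDisjointWalks.of_extend {U A B : Set V}
    (h : ∀ s, ∃ a ∈ A, ∃ b ∈ B, ReachableIn G (U \ {s}) a b)
    {a₁ a₂ t b₂ b : V} (p : G.Walk a₁ t) (q : G.Walk a₂ b₂)
    (hp : ∀ x ∈ p.support, x ∈ U) (hq : ∀ x ∈ q.support, x ∈ U)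
    (hpq : ∀ x ∈ p.support, x ∉ q.support) (ha₁ : a₁ ∈ A) (ha₂ : a₂ ∈ A) (hb₂ : b₂ ∈ B)
    (hb : b ∈ B) (hbU : b ∈ U) (htb : G.Adj t b) : HasDisjointWalks G U A B := by
  classical
  by_cases hbp : b ∈ p.support
  · exact ⟨a₁, ha₁, b, hb, a₂, ha₂, b₂, hb₂, p.takeUntil b hbp, q,
      fun x hx => hp x (p.support_takeUntil_subset_support hbp hx), hq,
      fun x hx => hpq x (p.support_takeUntil_subset_support hbp hx)⟩
  by_cases hbq : b ∈ q.support
  · obtain ⟨q', hq'path, hq'q⟩ : ∃ q' : G.Walk a₂ b, q'.IsPath ∧ ∀ x ∈ q'.support, x ∈ q.support :=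
      ⟨(q.takeUntil b hbq).bypass, Walk.bypass_isPath _, fun x hx =>
        q.support_takeUntil_subset_support hbq (Walk.support_bypass_subset_support _ hx)⟩
    obtain ⟨a, ha, b', hb', R, hR⟩ := h b
    rcases exists_walk_to_first_hit R.reverse {x | x ∈ p.support ∨ x ∈ q'.support} with
      hno | ⟨z, hz, r, hrR, hrz⟩
    · exact ⟨a, ha, b', hb', a₂, ha₂, b, hb, R, q', fun x hx => (hR x hx).1,
        fun x hx => hq x (hq'q x hx),
        fun x hx hx' => hno x (by simpa using hx) (Or.inr hx')⟩
    have hrU : ∀ x ∈ r.support, x ∈ U ∧ x ≠ b := fun x hx => hR x (by simpa using hrR x hx)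
    rcases hz with hz | hz
    · refine ⟨a₁, ha₁, b', hb', a₂, ha₂, b, hb, (p.takeUntil z hz).append r.reverse, q', ?_,
        fun x hx => hq x (hq'q x hx), ?_⟩
      · intro x hx
        rw [Walk.mem_support_append_iff] at hx
        rcases hx with hx | hx
        · exact hp x (p.support_takeUntil_subset_support hz hx)
        · exact (hrU x (by simpa using hx)).1
      · intro x hx hx'
        rw [Walk.mem_support_append_iff] at hx
        rcases hx with hx | hx
        · exact hpq x (p.support_takeUntil_subset_support hz hx) (hq'q x hx')
        · have := hrz x (by simpa using hx) (Or.inr hx')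
          subst this
          exact hpq x hz (hq'q x hx')
    · have hzb : z ≠ b := (hrU z r.end_mem_support).2
      refine ⟨a₁, ha₁, b, hb, a₂, ha₂, b', hb', p.concat htb,
        (q'.takeUntil z hz).append r.reverse, ?_, ?_, ?_⟩
      · intro x hx
        rw [Walk.support_concat, List.mem_append, List.mem_singleton] at hx
        rcases hx with hx | rfl
        exacts [hp x hx, hbU]
      · intro x hx
        rw [Walk.mem_support_append_iff] at hx
        rcases hx with hx | hx
        · exact hq x (hq'q x (q'.support_takeUntil_subset_support hz hx))
        · exact (hrU x (by simpa using hx)).1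
      · intro x hx hx'
        rw [Walk.support_concat, List.mem_append, List.mem_singleton] at hx
        rw [Walk.mem_support_append_iff] at hx'
        rcases hx with hx | rfl <;> rcases hx' with hx' | hx'
        · exact hpq x hx (hq'q x (q'.support_takeUntil_subset_support hz hx'))
        · have := hrz x (by simpa using hx') (Or.inl hx)
          subst this
          exact hpq x hx (hq'q x hz)
        · exact Walk.endpoint_notMem_support_takeUntil hq'path hz hzb.symm hx'
        · exact (hrU x (by simpa using hx')).2 rfl
  · refine ⟨a₁, ha₁, b, hb, a₂, ha₂, b₂, hb₂, p.concat htb, q, ?_, hq, ?_⟩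
    all_goals
      intro x hx
      rw [Walk.support_concat, List.mem_append, List.mem_singleton] at hx
      rcases hx with hx | rfl
    exacts [hp x hx, hbU, hpq x hx, hbq]

/-- Induction along a walk from `B` to `A`: its second vertex `t` is added to `B`. By disjointness
at most one of the walks obtained ends at `t`, and `of_extend` repairs that one. -/
theorem HasDisjointWalks.of_walk {U A : Set V} {b a : V} (p : G.Walk b a)
    (hpU : ∀ x ∈ p.support, x ∈ U) (ha : a ∈ A) (B : Set V) (hb : b ∈ B)
    (h : ∀ s, ∃ a ∈ A, ∃ b ∈ B, ReachableIn G (U \ {s}) a b) : HasDisjointWalks G U A B := by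
  induction p generalizing B with
  | @nil u =>
    obtain ⟨a', ha', b', hb', R, hR⟩ := h u
    exact ⟨u, ha, u, hb, a', ha', b', hb', .nil, R, hpU, fun x hx => (hR x hx).1,
      fun x hx hx' => (hR x hx').2 (by simpa using hx)⟩
  | @cons b t a hbt q ih =>
    have hbU : b ∈ U := hpU _ (by simp)
    obtain ⟨a₁, ha₁, b₁, hb₁, a₂, ha₂, b₂, hb₂, p', q', hp', hq', hpq⟩ :=
      ih (fun x hx => hpU x (by simp [hx])) ha (insert t B) (Set.mem_insert _ _) fun s => by
        obtain ⟨a, ha, b, hb, hab⟩ := h s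
        exact ⟨a, ha, b, Set.mem_insert_of_mem _ hb, hab⟩
    rcases hb₁ with rfl | hb₁ <;> rcases hb₂ with rfl | hb₂
    · exact absurd q'.end_mem_support (hpq _ p'.end_mem_support)
    · exact .of_extend h p' q' hp' hq' hpq ha₁ ha₂ hb₂ hb hbU hbt.symm
    · exact .of_extend h q' p' hq' hp' (fun x hx hx' => hpq x hx' hx) ha₂ ha₁ hb₁ hb hbU hbt.symm
    · exact ⟨a₁, ha₁, b₁, hb₁, a₂, ha₂, b₂, hb₂, p', q', hp', hq', hpq⟩

/-- Menger's theorem for two paths: if no single vertex separates `A` from `B` within `U`, then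
there are two disjoint paths from `A` to `B` within `U`. -/
theorem exists_disjoint_paths [Nonempty V] {U A B : Set V}
    (h : ∀ s, ∃ a ∈ A, ∃ b ∈ B, ReachableIn G (U \ {s}) a b) :
    ∃ a₁ ∈ A, ∃ b₁ ∈ B, ∃ a₂ ∈ A, ∃ b₂ ∈ B, ∃ (p : G.Walk a₁ b₁) (q : G.Walk a₂ b₂),
      p.IsPath ∧ q.IsPath ∧ (∀ x ∈ p.support, x ∈ U) ∧ (∀ x ∈ q.support, x ∈ U) ∧
      ∀ x ∈ p.support, x ∉ q.support := by
  classical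
  obtain ⟨a, ha, b, hb, R, hR⟩ := h (Classical.arbitrary V)
  obtain ⟨a₁, ha₁, b₁, hb₁, a₂, ha₂, b₂, hb₂, p, q, hp, hq, hpq⟩ :=
    HasDisjointWalks.of_walk R.reverse (fun x hx => (hR x (by simpa using hx)).1) ha B hb h
  exact ⟨a₁, ha₁, b₁, hb₁, a₂, ha₂, b₂, hb₂, p.bypass, q.bypass, p.bypass_isPath, q.bypass_isPath,
    fun x hx => hp x (p.support_bypass_subset_support hx),
    fun x hx => hq x (q.support_bypass_subset_support hx),
    fun x hx hx' => hpq x (p.support_bypass_subset_support hx) (q.support_bypass_subset_support hx')⟩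

/-! ### Gluing paths, and first consequences of 3-connectedness. -/

/-- Two paths with disjoint supports, joined by an edge, form a path. -/
theorem isPath_append_cons {a b c d : V} {p : G.Walk a b} {q : G.Walk c d} (hp : p.IsPath)
    (hq : q.IsPath) (h : G.Adj b c) (hpq : ∀ x ∈ p.support, x ∉ q.support) :
    (p.append (.cons h q)).IsPath := by
  rw [Walk.isPath_def, Walk.support_append, Walk.support_cons, List.tail_cons]
  exact List.nodup_append.2 ⟨hp.support_nodup, hq.support_nodup, fun x hx y hy hxy =>
    hpq x hx (hxy ▸ hy)⟩

theorem encard_pair_le_two (a b : V) : ({a, b} : Set V).encard ≤ 2 :=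
  (Set.encard_insert_le _ _).trans (by rw [Set.encard_singleton]; norm_num)

namespace IsKConnected

/-- The case `s = t` is allowed, and covers the deletion of a single vertex. -/
theorem reachableIn (hG : IsKConnected G 3) {s t u v : V} (hu : u ∉ ({s, t} : Set V))
    (hv : v ∉ ({s, t} : Set V)) :
    ReachableIn G {s, t}ᶜ u v := by
  have hcard : ({s, t} : Set V).encard < ((3 : ℕ) : ℕ∞) :=
    lt_of_le_of_lt (encard_pair_le_two s t) (by norm_num)
  obtain ⟨p⟩ := (hG.2 {s, t} hcard).preconnected ⟨u, hu⟩ ⟨v, hv⟩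
  have hp : ∀ x ∈ (p.map (Embedding.induce _).toHom).support, x ∈ ({s, t} : Set V)ᶜ := by
    intro x hx
    rw [Walk.support_map, List.mem_map] at hx
    obtain ⟨y, -, rfl⟩ := hx
    exact y.2
  exact ⟨_, hp⟩

theorem exists_ne (hG : IsKConnected G 3) (a b c : V) : ∃ d, d ≠ a ∧ d ≠ b ∧ d ≠ c := by
  by_contra! h
  have hle : (Set.univ : Set V).encard ≤ ({a, b, c} : Set V).encard :=
    Set.encard_le_encard fun d _ => by
      by_cases h1 : d = a
      · simp [h1]
      by_cases h2 : d = b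
      · simp [h2]
      simp [h d h1 h2]
  have h3 : ({a, b, c} : Set V).encard ≤ 3 := by
    refine (Set.encard_insert_le _ _).trans ?_
    calc ({b, c} : Set V).encard + 1 ≤ 2 + 1 := by gcongr; exact encard_pair_le_two b c
      _ = 3 := by norm_num
  have := hG.1
  rw [Set.encard_univ] at hle
  exact absurd (hle.trans h3) (not_le.2 this)

theorem exists_adj_ne (hG : IsKConnected G 3) {v : V} {s t : V} (hs : v ≠ s) (ht : v ≠ t) :
    ∃ u, G.Adj v u ∧ u ≠ s ∧ u ≠ t := by
  obtain ⟨d, hd, hd1, hd2⟩ := hG.exists_ne v s t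
  obtain ⟨p, hp⟩ := hG.reachableIn (s := s) (t := t) (u := v) (v := d) (by simp [hs, ht])
    (by simp [hd1, hd2])
  cases p with
  | nil => exact absurd rfl hd
  | @cons _ u _ h q =>
    have := hp u (by simp)
    simp only [Set.mem_compl_iff, Set.mem_insert_iff, Set.mem_singleton_iff, not_or] at this
    exact ⟨u, h, this⟩

end IsKConnected

/-! ### Thin bonds. -/

/-- The pairs of vertices with exactly one end in `X`. -/
def boundary (X : Set V) : Set (Sym2 V) := {e | ∃ x ∈ X, ∃ y ∈ Xᶜ, e = s(x, y)}

theorem boundary_compl (X : Set V) : boundary Xᶜ = boundary X := by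
  ext e
  constructor
  · rintro ⟨x, hx, y, hy, rfl⟩
    exact ⟨y, by simpa using hy, x, hx, Sym2.eq_swap⟩
  · rintro ⟨x, hx, y, hy, rfl⟩
    exact ⟨y, hy, x, by simpa using hx, Sym2.eq_swap⟩

/-- No circuit of `G` contains three distinct members of `D`. -/
def AtMostTwoOnCircuits (G : SimpleGraph V) (D : Set (Sym2 V)) : Prop :=
  ∀ (v : V) (c : G.Walk v v), c.IsCycle → ∀ e₁ ∈ c.edges, ∀ e₂ ∈ c.edges, ∀ e₃ ∈ c.edges,
    e₁ ∈ D → e₂ ∈ D → e₃ ∈ D → e₁ ≠ e₂ → e₁ ≠ e₃ → e₂ ≠ e₃ → False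

/-- Both `X` and its complement are connected, and no circuit crosses from `X` to its
complement more than twice. -/
structure IsThinBond (G : SimpleGraph V) (X : Set V) : Prop where
  conn : PreconnectedIn G X
  conn_compl : PreconnectedIn G Xᶜ
  atMostTwo : AtMostTwoOnCircuits G (boundary X)

namespace IsThinBond

variable {X : Set V}

theorem compl (h : IsThinBond G X) : IsThinBond G Xᶜ where
  conn := h.conn_compl
  conn_compl := by simpa using h.conn
  atMostTwo := by simpa [boundary_compl] using h.atMostTwo

/-- Two disjoint connected subsets of one side of a thin bond have neighbourhoods in the other
side that are separated there by a single vertex. -/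
theorem exists_separator (h : IsThinBond G X) (hY : Xᶜ.Nonempty) {X₁ X₂ : Set V} (h₁ : X₁ ⊆ X)
    (h₂ : X₂ ⊆ X) (hdisj : ∀ x ∈ X₁, x ∉ X₂) (hc₁ : PreconnectedIn G X₁)
    (hc₂ : PreconnectedIn G X₂) :
    ∃ s ∈ Xᶜ, ∀ x₁ ∈ X₁, ∀ y₁, G.Adj x₁ y₁ → ∀ x₂ ∈ X₂, ∀ y₂, G.Adj x₂ y₂ →
      ¬ ReachableIn G (Xᶜ \ {s}) y₁ y₂ := by
  by_contra! hcon
  obtain ⟨s₀, hs₀⟩ := hY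
  have : Nonempty V := ⟨s₀⟩
  have hcon' : ∀ s, ∃ x₁ ∈ X₁, ∃ y₁, G.Adj x₁ y₁ ∧ ∃ x₂ ∈ X₂, ∃ y₂, G.Adj x₂ y₂ ∧
      ReachableIn G (Xᶜ \ {s}) y₁ y₂ := fun s => by
    by_cases hs : s ∈ Xᶜ
    · exact hcon s hs
    obtain ⟨x₁, hx₁, y₁, hy₁, x₂, hx₂, y₂, hy₂, hr⟩ := hcon s₀ hs₀
    exact ⟨x₁, hx₁, y₁, hy₁, x₂, hx₂, y₂, hy₂,
      hr.mono fun z hz => ⟨hz.1, fun e => hs (Set.mem_singleton_iff.1 e ▸ hz.1)⟩⟩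
  -- Menger gives two disjoint paths in `Xᶜ`. Closed up by a path in `X₁` and one in `X₂`, they form
  -- a circuit with four boundary edges, of which three are exhibited below.
  obtain ⟨a₁, ⟨x₁, hx₁, ha₁⟩, b₁, ⟨x₃, hx₃, hb₁⟩, a₂, ⟨x₂, hx₂, ha₂⟩, b₂, ⟨x₄, hx₄, hb₂⟩, p, q,
      hp, hq, hpU, hqU, hpq⟩ :=
    exists_disjoint_paths (G := G) (U := Xᶜ) (A := {y | ∃ x ∈ X₁, G.Adj x y})
      (B := {y | ∃ x ∈ X₂, G.Adj x y}) fun s => by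
        obtain ⟨x₁, hx₁, y₁, hy₁, x₂, hx₂, y₂, hy₂, hr⟩ := hcon' s
        exact ⟨y₁, ⟨x₁, hx₁, hy₁⟩, y₂, ⟨x₂, hx₂, hy₂⟩, hr⟩
  obtain ⟨r, hr, hrU⟩ := (hc₁ x₂ hx₂ x₁ hx₁).exists_isPath
  obtain ⟨t, ht, htU⟩ := (hc₂ x₃ hx₃ x₄ hx₄).exists_isPath
  have hrX : ∀ x ∈ r.support, x ∈ X := fun x hx => h₁ (hrU x hx)
  have htX : ∀ x ∈ t.support, x ∈ X := fun x hx => h₂ (htU x hx)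
  have ha₁Y : a₁ ∈ Xᶜ := hpU _ p.start_mem_support
  have hb₁Y : b₁ ∈ Xᶜ := hpU _ p.end_mem_support
  have hb₂Y : b₂ ∈ Xᶜ := hqU _ q.end_mem_support
  have hbb : b₁ ≠ b₂ := fun e => hpq _ p.end_mem_support (e ▸ q.end_mem_support)
  have hx₁X := h₁ hx₁
  have hx₃X := h₂ hx₃
  have hx₄X := h₂ hx₄
  have hne₁₃ : x₁ ≠ x₃ := fun e => hdisj _ hx₁ (e ▸ hx₃)
  have hne₁₄ : x₁ ≠ x₄ := fun e => hdisj _ hx₁ (e ▸ hx₄)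
  have hP₁ := isPath_append_cons hr hp ha₁ fun x hx hx' => hpU x hx' (hrX x hx)
  have hP₂ := isPath_append_cons ht hq.reverse hb₂ fun x hx hx' =>
    hqU x (by simpa using hx') (htX x hx)
  have hP := isPath_append_cons hP₁ hP₂ hb₁.symm fun x hx hx' => by
    simp only [Walk.mem_support_append_iff, Walk.support_cons, List.mem_cons, Walk.support_reverse,
      List.mem_reverse] at hx hx'
    have hx : x ∈ r.support ∨ x ∈ p.support := by
      rcases hx with hx | rfl | hx
      exacts [Or.inl hx, Or.inl r.end_mem_support, Or.inr hx]
    have hx' : x ∈ t.support ∨ x ∈ q.support := by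
      rcases hx' with hx | rfl | hx
      exacts [Or.inl hx, Or.inl t.end_mem_support, Or.inr hx]
    rcases hx with hx | hx <;> rcases hx' with hx' | hx'
    · exact hdisj x (hrU x hx) (htU x hx')
    · exact hqU x hx' (hrX x hx)
    · exact hpU x hx (htX x hx')
    · exact hpq x hx hx'
  have hC := (Walk.cons_isCycle_iff _ ha₂.symm).2 ⟨hP, fun hmem => by
    have := hP.length_eq_one_of_mem_edges (Sym2.eq_swap ▸ hmem)
    simp only [Walk.length_append, Walk.length_cons] at this
    omega⟩
  refine h.atMostTwo _ _ hC s(x₁, a₁) (by simp) s(x₃, b₁) (by simp [Sym2.eq_swap]) s(x₄, b₂)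
    (by simp) ⟨_, hx₁X, _, ha₁Y, rfl⟩ ⟨_, hx₃X, _, hb₁Y, rfl⟩ ⟨_, hx₄X, _, hb₂Y, rfl⟩ ?_ ?_ ?_
  · simp only [ne_eq, Sym2.eq_iff, not_or, not_and]
    exact ⟨fun e => absurd e hne₁₃, fun e => absurd (e ▸ hx₁X) hb₁Y⟩
  · simp only [ne_eq, Sym2.eq_iff, not_or, not_and]
    exact ⟨fun e => absurd e hne₁₄, fun e => absurd (e ▸ hx₁X) hb₂Y⟩
  · simp only [ne_eq, Sym2.eq_iff, not_or, not_and]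
    exact ⟨fun _ => hbb, fun e => absurd (e ▸ hx₃X) hb₂Y⟩

/-- If `X` is split into connected parts `X₁` and `X₂ ⊈ {x}` such that all edges between them
contain `x`, then `X₁ ⊆ {x}`, and `X₁` has at most one neighbour outside `X`. -/
theorem of_split (hG : IsKConnected G 3) (h : IsThinBond G X) (hY : Xᶜ.Nonempty)
    {X₁ X₂ : Set V} (hX : X = X₁ ∪ X₂) (hdisj : ∀ x ∈ X₁, x ∉ X₂) (hc₁ : PreconnectedIn G X₁)
    (hc₂ : PreconnectedIn G X₂) {x v : V} (hx : x ∈ X)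
    (hedge : ∀ a ∈ X₁, ∀ b ∈ X₂, G.Adj a b → a = x ∨ b = x) (hv : v ∈ X₂) (hvx : v ≠ x) :
    X₁ ⊆ {x} ∧ ∃ s, ∀ a ∈ X₁, ∀ y ∈ Xᶜ, G.Adj a y → y = s := by
  have h₁ : X₁ ⊆ X := hX ▸ Set.subset_union_left
  have h₂ : X₂ ⊆ X := hX ▸ Set.subset_union_right
  obtain ⟨s, hsY, hs⟩ := h.exists_separator hY h₁ h₂ hdisj hc₁ hc₂
  -- `T` consists of `X₁` and all that its neighbours reach in `Xᶜ \ {s}`. Outside `{x, s}` no edge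
  -- leaves `T`, and `v ∉ T`, so 3-connectedness forces `T ⊆ {x, s}`.
  set T : Set V :=
    {u | u ∈ X₁ ∨ ∃ a ∈ X₁, ∃ y, G.Adj a y ∧ ReachableIn G (Xᶜ \ {s}) y u} with hT
  have key : ∀ u ∈ T, u ≠ x → u ≠ s → False := by
    intro u hu hux hus
    have hvT := (hG.reachableIn (s := x) (t := s) (u := u) (v := v) (by simp [hux, hus])
      (by simpa [hvx] using fun e : v = s => hsY (e ▸ h₂ hv))).mem_of_closed
      (T := {u | u ∈ T ∧ u ≠ x}) ⟨hu, hux⟩ ?_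
    · rcases hvT.1 with hv' | ⟨a, -, y, -, hr⟩
      · exact hdisj v hv' hv
      · exact hr.right_mem.1 (h₂ hv)
    · rintro t ⟨ht, htx⟩ t' ht' hadj
      simp only [Set.mem_compl_iff, Set.mem_insert_iff, Set.mem_singleton_iff, not_or] at ht'
      refine ⟨?_, ht'.1⟩
      by_cases ht'X : t' ∈ X
      · rw [hX] at ht'X
        rcases ht'X with ht'X | ht'X
        · exact Or.inl ht'X
        rcases ht with ht | ⟨a, ha, y, hay, hr⟩
        · exact absurd (hedge t ht t' ht'X hadj) (by simp [htx, ht'.1])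
        · exact absurd hr (hs a ha y hay t' ht'X t hadj.symm)
      · rcases ht with ht | ⟨a, ha, y, hay, hr⟩
        · exact Or.inr ⟨t, ht, t', hadj, .refl ⟨ht'X, by simpa using ht'.2⟩⟩
        · exact Or.inr ⟨a, ha, y, hay, hr.trans
            (.of_adj hadj hr.right_mem ⟨ht'X, by simpa using ht'.2⟩)⟩
  refine ⟨fun u hu => ?_, s, fun a ha y hy hay => ?_⟩
  · by_contra hux
    exact key u (Or.inl hu) (by simpa using hux) fun e => hsY (e ▸ h₁ hu)
  · by_contra hys
    exact key y (Or.inr ⟨a, ha, y, hay, .refl ⟨hy, by simpa using hys⟩⟩)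
      (fun e => hy (e ▸ hx)) hys

/-- Deleting a vertex from one side of a thin bond leaves that side connected. -/
theorem preconnectedIn_diff (hG : IsKConnected G 3) (h : IsThinBond G X) (hY : Xᶜ.Nonempty)
    {x : V} (hx : x ∈ X) : PreconnectedIn G (X \ {x}) := by
  classical
  intro u hu v hv
  by_contra huv
  -- `K` is the component of `u` in `X \ {x}`. The rest of `X` is connected through `x`, so
  -- `of_split` would give `K ⊆ {x}`.
  set K : Set V := {z | ReachableIn G (X \ {x}) u z} with hK
  have hKX : K ⊆ X \ {x} := fun z hz => ReachableIn.right_mem hz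
  have huK : u ∈ K := .refl hu
  have hc₁ : PreconnectedIn G K := by
    have : ∀ z ∈ K, ReachableIn G K u z := by
      rintro z ⟨p, hp⟩
      exact ⟨p, fun y hy => ⟨p.takeUntil y hy, fun w hw =>
        hp w (p.support_takeUntil_subset_support hy hw)⟩⟩
    exact fun a ha b hb => (this a ha).symm.trans (this b hb)
  have hc₂ : PreconnectedIn G (X \ K) := by
    have : ∀ z ∈ X \ K, ReachableIn G (X \ K) z x := by
      rintro z ⟨hzX, hzK⟩
      obtain ⟨p, hp, hpX⟩ := (h.conn z hzX x hx).exists_isPath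
      refine ⟨p, fun y hy => ⟨hpX y hy, fun hyK => hzK ?_⟩⟩
      have hyx : x ≠ y := fun e => (hKX hyK).2 e.symm
      refine ReachableIn.trans hyK (ReachableIn.symm ⟨p.takeUntil y hy, fun w hw =>
        ⟨hpX w (p.support_takeUntil_subset_support hy hw), ?_⟩⟩)
      rintro rfl
      exact Walk.endpoint_notMem_support_takeUntil hp hy hyx hw
    exact fun a ha b hb => (this a ha).trans (this b hb).symm
  have hsub := (of_split hG h hY (X₁ := K) (X₂ := X \ K)
    (Set.union_sdiff_cancel fun z hz => (hKX hz).1).symm (fun z hz hz' => hz'.2 hz) hc₁ hc₂ hx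
    (fun a ha b hb hab => ?_) ⟨hv.1, huv⟩ hv.2).1 huK
  · exact hu.2 hsub
  · by_contra! hne
    exact hb.2 (ReachableIn.trans ha (.of_adj hab (hKX ha) ⟨hb.1, hne.2⟩))

/-- If a side of a thin bond has a second vertex, then each of its vertices has at most one
neighbour on the other side. -/
theorem eq_of_adj_of_adj (hG : IsKConnected G 3) (h : IsThinBond G X) (hX : X.Nontrivial)
    {x y y' : V} (hx : x ∈ X) (hy : y ∈ Xᶜ) (hy' : y' ∈ Xᶜ) (hxy : G.Adj x y)
    (hxy' : G.Adj x y') : y = y' := by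
  obtain ⟨v, hv, hvx⟩ := hX.exists_ne x
  obtain ⟨-, s, hs⟩ := of_split hG h ⟨y, hy⟩ (X₁ := {x}) (X₂ := X \ {x}) (x := x) (v := v)
    (Set.union_sdiff_cancel (by simpa using hx)).symm (by simp)
    (by rintro a rfl b rfl; exact .refl rfl) (preconnectedIn_diff hG h ⟨y, hy⟩ hx) hx
    (fun a ha b _ _ => Or.inl ha) ⟨hv, hvx⟩ hvx
  rw [hs x rfl y hy hxy, hs x rfl y' hy' hxy']

/-- The edges of a thin bond with nontrivial sides are determined by their ends in either side. -/
theorem left_ne_of_edge_ne (hG : IsKConnected G 3) (h : IsThinBond G X) (hX : X.Nontrivial)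
    {x₁ y₁ x₂ y₂ : V} (hx₁ : x₁ ∈ X) (hy₁ : y₁ ∈ Xᶜ) (hy₂ : y₂ ∈ Xᶜ)
    (h₁ : G.Adj x₁ y₁) (h₂ : G.Adj x₂ y₂) (hne : s(x₁, y₁) ≠ s(x₂, y₂)) : x₁ ≠ x₂ := by
  rintro rfl
  exact hne (by rw [eq_of_adj_of_adj hG h hX hx₁ hy₁ hy₂ h₁ h₂])

/-- A thin bond in a 3-connected graph that is not a vertex star has at most three edges. -/
theorem not_four_edges (hG : IsKConnected G 3) (h : IsThinBond G X) (hX : X.Nontrivial)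
    (hY : Xᶜ.Nontrivial) (e : Fin 4 → G.edgeSet) (he : Function.Injective e)
    (hD : ∀ i, (e i : Sym2 V) ∈ boundary X) : False := by
  choose x hx y hy hxy using hD
  have hadj : ∀ i, G.Adj (x i) (y i) := fun i => by
    rw [← SimpleGraph.mem_edgeSet, ← hxy i]; exact (e i).2
  have hine : ∀ i j, i ≠ j → s(x i, y i) ≠ s(x j, y j) := fun i j hij hh =>
    hij (he (Subtype.ext (by rw [hxy, hxy, hh])))
  have hxne : ∀ i j, i ≠ j → x i ≠ x j := fun i j hij =>
    left_ne_of_edge_ne hG h hX (hx i) (hy i) (hy j) (hadj i) (hadj j) (hine i j hij)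
  have hyne : ∀ i j, i ≠ j → y i ≠ y j := fun i j hij =>
    left_ne_of_edge_ne hG h.compl hY (hy i) (by simpa using hx i) (by simpa using hx j)
      (hadj i).symm (hadj j).symm (by
        rw [Sym2.eq_swap, Sym2.eq_swap (a := y j)]; exact hine i j hij)
  have : Nonempty V := ⟨x 0⟩
  obtain ⟨a₁, ha₁, b₁, hb₁, a₂, ha₂, b₂, hb₂, p, q, -, -, hpX, hqX, hpq⟩ :=
    exists_disjoint_paths (G := G) (U := X) (A := {x 0, x 1}) (B := {x 2, x 3}) fun s => by
      have hA : ∃ a ∈ ({x 0, x 1} : Set V), a ∈ X \ {s} := by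
        by_cases h0 : x 0 = s
        · exact ⟨x 1, by simp, hx 1, fun e => hxne 0 1 (by decide) (h0.trans e.symm)⟩
        · exact ⟨x 0, by simp, hx 0, h0⟩
      have hB : ∃ b ∈ ({x 2, x 3} : Set V), b ∈ X \ {s} := by
        by_cases h0 : x 2 = s
        · exact ⟨x 3, by simp, hx 3, fun e => hxne 2 3 (by decide) (h0.trans e.symm)⟩
        · exact ⟨x 2, by simp, hx 2, h0⟩
      obtain ⟨a, ha, ha'⟩ := hA
      obtain ⟨b, hb, hb'⟩ := hB
      refine ⟨a, ha, b, hb, ?_⟩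
      by_cases hs : s ∈ X
      · exact preconnectedIn_diff hG h hY.nonempty hs a ha' b hb'
      · rw [Set.sdiff_singleton_eq_self hs]
        exact h.conn a ha'.1 b hb'.1
  obtain ⟨s, hs, hsep⟩ := h.exists_separator hY.nonempty (X₁ := {z | z ∈ p.support})
    (X₂ := {z | z ∈ q.support}) hpX hqX hpq (preconnectedIn_support p) (preconnectedIn_support q)
  -- Each of the two paths contains two of the `x i`, whose partners `y i` differ, so one partner is
  -- not `s`. As `Xᶜ \ {s}` is connected, `s` separates nothing.
  have partner : ∀ {a b : V} (r : G.Walk a b), a ∈ ({x 0, x 1} : Set V) →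
      b ∈ ({x 2, x 3} : Set V) → ∃ z ∈ r.support, ∃ w ∈ Xᶜ \ {s}, G.Adj z w := by
    intro a b r ha hb
    obtain ⟨i, j, hij, rfl, rfl⟩ : ∃ i j, i ≠ j ∧ a = x i ∧ b = x j := by
      rcases ha with rfl | rfl <;> rcases hb with rfl | rfl
      exacts [⟨0, 2, by decide, rfl, rfl⟩, ⟨0, 3, by decide, rfl, rfl⟩,
        ⟨1, 2, by decide, rfl, rfl⟩, ⟨1, 3, by decide, rfl, rfl⟩]
    by_cases h0 : y i = s
    · exact ⟨x j, r.end_mem_support, y j, ⟨hy j, fun e => hyne i j hij (h0.trans e.symm)⟩, hadj j⟩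
    · exact ⟨x i, r.start_mem_support, y i, ⟨hy i, h0⟩, hadj i⟩
  obtain ⟨z, hz, w, hw, hzw⟩ := partner p ha₁ hb₁
  obtain ⟨z', hz', w', hw', hzw'⟩ := partner q ha₂ hb₂
  exact hsep z hz w hzw z' hz' w' hzw'
    (preconnectedIn_diff hG h.compl (by simpa using hX.nonempty) hs w hw w' hw')

/-- Each edge inside one side of a thin bond lies on a circuit inside
that side. -/
theorem exists_path_avoiding_edge (hG : IsKConnected G 3) (h : IsThinBond G X)
    (hY : Xᶜ.Nonempty) {a b : V} (ha : a ∈ X) (hb : b ∈ X) (hab : G.Adj a b) :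
    ∃ p : G.Walk a b, p.IsPath ∧ s(a, b) ∉ p.edges ∧ ∀ z ∈ p.support, z ∈ X := by
  classical
  -- `a` has at least three neighbours, and at most one lies outside `X`.
  obtain ⟨r, hr, har, hrb⟩ : ∃ r ∈ X, r ≠ b ∧ G.Adj a r := by
    by_cases hay : ∃ y ∈ Xᶜ, G.Adj a y
    · obtain ⟨y, hy, hay⟩ := hay
      obtain ⟨r, har, hrb, hry⟩ := hG.exists_adj_ne hab.ne hay.ne
      refine ⟨r, ?_, hrb, har⟩
      by_contra hr
      exact hry (eq_of_adj_of_adj hG h ⟨a, ha, b, hb, hab.ne⟩ ha hr hy har hay)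
    · obtain ⟨r, har, hrb, -⟩ := hG.exists_adj_ne hab.ne hab.ne
      exact ⟨r, by_contra fun hr => hay ⟨r, hr, har⟩, hrb, har⟩
  obtain ⟨q, hq, hqX⟩ := (preconnectedIn_diff hG h hY ha r ⟨hr, hrb.ne'⟩ b
    ⟨hb, hab.ne'⟩).exists_isPath
  refine ⟨.cons hrb q, hq.cons fun hh => (hqX a hh).2 rfl, fun hh => ?_, fun z hz => ?_⟩
  · rw [Walk.edges_cons, List.mem_cons] at hh
    rcases hh with hh | hh
    · rcases Sym2.eq_iff.1 hh with ⟨-, e⟩ | ⟨e, -⟩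
      exacts [har e.symm, hrb.ne e]
    · exact (hqX a (q.fst_mem_support_of_mem_edges hh)).2 rfl
  · rw [Walk.support_cons, List.mem_cons] at hz
    rcases hz with rfl | hz
    exacts [ha, (hqX z hz).1]

end IsThinBond

/-! ### Thin cuts and their bonds. -/

/-- Every circuit of `G` contains either no member of `D` or exactly two. -/
structure IsThinCut (G : SimpleGraph V) (D : Set (Sym2 V)) : Prop where
  exists_other : ∀ (v : V) (c : G.Walk v v), c.IsCycle → ∀ e ∈ c.edges, e ∈ D →
    ∃ e' ∈ c.edges, e' ≠ e ∧ e' ∈ D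
  atMostTwo : AtMostTwoOnCircuits G D

/-- In a 3-connected graph, any two vertices other than `v` are the ends of a path through `v`. -/
theorem exists_isPath_through (hG : IsKConnected G 3) {x y v : V} (hxy : x ≠ y) (hx : v ≠ x)
    (hy : v ≠ y) : ∃ p : G.Walk x y, p.IsPath ∧ v ∈ p.support := by
  have : Nonempty V := ⟨v⟩
  obtain ⟨a₁, ha₁, b₁, hb₁, a₂, ha₂, b₂, hb₂, p, q, hp, hq, hpU, hqU, hpq⟩ :=
    exists_disjoint_paths (G := G) (U := {v}ᶜ) (A := {x, y}) (B := {b | G.Adj v b}) fun s => by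
      have hA : ∃ a ∈ ({x, y} : Set V), a ≠ v ∧ a ≠ s := by
        by_cases h0 : x = s
        · exact ⟨y, by simp, hy.symm, fun e => hxy (h0.trans e.symm)⟩
        · exact ⟨x, by simp, hx.symm, h0⟩
      obtain ⟨a, ha, hav, has⟩ := hA
      obtain ⟨b, hb, hbs⟩ : ∃ b, G.Adj v b ∧ b ≠ s := by
        by_cases hvs : v = s
        · obtain ⟨b, hb, -⟩ := hG.exists_adj_ne hx hx
          exact ⟨b, hb, hvs ▸ hb.ne'⟩
        · obtain ⟨b, hb, hbs, -⟩ := hG.exists_adj_ne hvs hvs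
          exact ⟨b, hb, hbs⟩
      refine ⟨a, ha, b, hb, (hG.reachableIn (s := v) (t := s) (by simp [hav, has])
        (by simp [hb.ne', hbs])).mono fun z hz => ?_⟩
      simpa using hz
  have key : ∀ {a₁ a₂ b₁ b₂ : V} (p : G.Walk a₁ b₁) (q : G.Walk a₂ b₂), p.IsPath → q.IsPath →
      (∀ x ∈ p.support, x ∈ ({v}ᶜ : Set V)) → (∀ x ∈ q.support, x ∈ ({v}ᶜ : Set V)) →
      (∀ x ∈ p.support, x ∉ q.support) → G.Adj v b₁ → G.Adj v b₂ →
      ∃ r : G.Walk a₁ a₂, r.IsPath ∧ v ∈ r.support := by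
    intro a₁ a₂ b₁ b₂ p q hp hq hpU hqU hpq hb₁ hb₂
    refine ⟨p.append (.cons hb₁.symm (.cons hb₂ q.reverse)),
      isPath_append_cons hp (hq.reverse.cons fun hh => hqU v (by simpa using hh) rfl) _ ?_,
      by simp⟩
    intro z hz hz'
    simp only [Walk.support_cons, List.mem_cons, Walk.support_reverse, List.mem_reverse] at hz'
    rcases hz' with rfl | hz'
    exacts [hpU z hz rfl, hpq z hz hz']
  have hne : a₁ ≠ a₂ := fun e => hpq _ p.start_mem_support (e ▸ q.start_mem_support)
  rcases ha₁ with rfl | rfl <;> rcases ha₂ with rfl | rfl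
  · exact absurd rfl hne
  · exact key p q hp hq hpU hqU hpq hb₁ hb₂
  · exact key q p hq hp hqU hpU (fun x hx hx' => hpq x hx' hx) hb₂ hb₁
  · exact absurd rfl hne

theorem reachable_deleteEdges_of_walk {D : Set (Sym2 V)} {a b : V} (p : G.Walk a b)
    (hp : ∀ e ∈ p.edges, e ∉ D) : (G.deleteEdges D).Reachable a b :=
  ⟨p.toDeleteEdges D hp⟩

/-- A path with an interior vertex does not contain an edge joining its ends. -/
theorem notMem_edges_of_mem_support {x y v : V} {p : G.Walk x y} (hp : p.IsPath)
    (hv : v ∈ p.support) (hx : v ≠ x) (hy : v ≠ y) : s(x, y) ∉ p.edges := by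
  intro hmem
  rw [hp.eq_adj_toWalk_of_mem_edges hmem] at hv
  simp [hx, hy] at hv

/-- A nonempty thin cut of a 3-connected graph is the boundary of a thin bond. -/
theorem IsThinCut.exists_bond (hG : IsKConnected G 3) {D : Set (Sym2 V)} (hD : IsThinCut G D)
    {x₀ y₀ : V} (h₀ : G.Adj x₀ y₀) (h₀D : s(x₀, y₀) ∈ D) :
    ∃ X, IsThinBond G X ∧ x₀ ∈ X ∧ y₀ ∈ Xᶜ ∧
      ∀ e ∈ G.edgeSet, e ∈ D ↔ e ∈ boundary X := by
  classical
  set H := G.deleteEdges D with hH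
  -- A path avoiding `D` between the ends of an edge of `D` would close to a circuit with just one
  -- edge in `D`.
  have hsep : ∀ a b, G.Adj a b → s(a, b) ∈ D → ¬ H.Reachable a b := by
    intro a b hab habD hr
    obtain ⟨p, hp⟩ := hr.exists_isPath
    have hpD : ∀ e ∈ p.edges, e ∉ D := fun e he =>
      ((SimpleGraph.edgeSet_deleteEdges (G := G) D) ▸ p.edges_subset_edgeSet he).2
    have hle : H ≤ G := G.deleteEdges_le D
    have hc := (Walk.cons_isCycle_iff (p.mapLe hle) hab.symm).2 ⟨hp.mapLe hle, fun hh => by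
      rw [Walk.edges_mapLe_eq_edges] at hh
      exact hpD _ hh (Sym2.eq_swap ▸ habD)⟩
    obtain ⟨e', he', hne, he'D⟩ := hD.exists_other _ _ hc s(b, a) (by simp) (Sym2.eq_swap ▸ habD)
    rw [Walk.edges_cons, List.mem_cons, Walk.edges_mapLe_eq_edges] at he'
    exact he'.elim hne fun hh => hpD _ hh he'D
  -- A path from `x₀` to `y₀` through `v` closes up with `x₀y₀ ∈ D`, so it has at most one edge in
  -- `D`, and one of its halves at `v` avoids `D`.
  have hcover : ∀ v, H.Reachable x₀ v ∨ H.Reachable v y₀ := by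
    intro v
    by_cases hx : v = x₀
    · exact Or.inl (hx ▸ .rfl)
    by_cases hy : v = y₀
    · exact Or.inr (hy ▸ .rfl)
    obtain ⟨p, hp, hv⟩ := exists_isPath_through hG h₀.ne hx hy
    have hmem := notMem_edges_of_mem_support hp hv hx hy
    have hc := (Walk.cons_isCycle_iff p h₀.symm).2 ⟨hp, by rwa [Sym2.eq_swap]⟩
    by_contra! hcon
    have h1 : ∃ e ∈ (p.takeUntil v hv).edges, e ∈ D := by
      by_contra! hh
      exact hcon.1 (reachable_deleteEdges_of_walk _ hh)
    have h2 : ∃ e ∈ (p.dropUntil v hv).edges, e ∈ D := by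
      by_contra! hh
      exact hcon.2 (reachable_deleteEdges_of_walk _ hh)
    obtain ⟨e₁, he₁, he₁D⟩ := h1
    obtain ⟨e₂, he₂, he₂D⟩ := h2
    have he₁p := p.edges_takeUntil_subset_edges hv he₁
    have he₂p := p.edges_dropUntil_subset_edges hv he₂
    refine hD.atMostTwo _ _ hc s(y₀, x₀) (by simp) e₁ (by simp [he₁p]) e₂ (by simp [he₂p])
      (Sym2.eq_swap ▸ h₀D) he₁D he₂D ?_ ?_ ?_
    · rintro rfl
      exact hmem (Sym2.eq_swap ▸ he₁p)
    · rintro rfl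
      exact hmem (Sym2.eq_swap ▸ he₂p)
    · rintro rfl
      exact hp.isTrail.disjoint_edges_takeUntil_dropUntil hv he₁ he₂
  have hx₀y₀ := hsep x₀ y₀ h₀ h₀D
  set X : Set V := {v | H.Reachable x₀ v} with hXdef
  have hXc : ∀ v, v ∈ Xᶜ ↔ H.Reachable y₀ v := fun v =>
    ⟨fun hv => ((hcover v).resolve_left hv).symm, fun hv hv' => hx₀y₀ (hv'.trans hv.symm)⟩
  have hreach : ∀ (U : Set V) (z : V), (∀ v, v ∈ U ↔ H.Reachable z v) → PreconnectedIn G U := by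
    intro U z hU
    have : ∀ v ∈ U, ReachableIn G U z v := by
      intro v hv
      obtain ⟨p⟩ := (hU v).1 hv
      refine ⟨p.mapLe (G.deleteEdges_le D), fun w hw => (hU w).2 ?_⟩
      rw [Walk.support_mapLe_eq_support] at hw
      exact ⟨p.takeUntil w hw⟩
    exact fun a ha b hb => (this a ha).symm.trans (this b hb)
  have hbd : ∀ e ∈ G.edgeSet, e ∈ D ↔ e ∈ boundary X := by
    intro e he
    induction e using Sym2.ind with | _ a b =>
    have hab : G.Adj a b := he
    constructor
    · intro habD
      have hn := hsep a b hab habD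
      by_cases ha : a ∈ X
      · exact ⟨a, ha, b, fun hb => hn (ha.symm.trans hb), rfl⟩
      · refine ⟨b, ?_, a, ha, Sym2.eq_swap⟩
        by_contra hb
        exact hn (((hXc a).1 ha).symm.trans ((hXc b).1 hb))
    · rintro ⟨x, hx, y, hy, hxy⟩
      by_contra hnD
      rw [hxy] at he hnD
      have hadj : H.Adj x y := by
        rw [hH, SimpleGraph.deleteEdges_adj]
        exact ⟨he, hnD⟩
      exact hy (Reachable.trans hx hadj.reachable)
  refine ⟨X, ⟨hreach X x₀ fun _ => Iff.rfl, hreach Xᶜ y₀ hXc, ?_⟩, .rfl, hx₀y₀, hbd⟩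
  intro v c hc e₁ h₁ e₂ h₂ e₃ h₃ h₁' h₂' h₃'
  exact hD.atMostTwo v c hc e₁ h₁ e₂ h₂ e₃ h₃ ((hbd _ (c.edges_subset_edgeSet h₁)).2 h₁')
    ((hbd _ (c.edges_subset_edgeSet h₂)).2 h₂') ((hbd _ (c.edges_subset_edgeSet h₃)).2 h₃')

/-- A thin cut that contains an edge inside one side of a thin bond contains another one. -/
theorem IsThinBond.exists_other_edge (hG : IsKConnected G 3) {X : Set V} (h : IsThinBond G X)
    (hY : Xᶜ.Nonempty) {D : Set (Sym2 V)} (hD : IsThinCut G D) (e : G.edgeSet)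
    (heD : (e : Sym2 V) ∈ D) (heX : ∀ z ∈ (e : Sym2 V), z ∈ X) :
    ∃ e' : G.edgeSet, e' ≠ e ∧ (e' : Sym2 V) ∈ D ∧ ∀ z ∈ (e' : Sym2 V), z ∈ X := by
  obtain ⟨e, he⟩ := e
  induction e using Sym2.ind with | _ a b =>
  have hab : G.Adj a b := he
  obtain ⟨p, hp, hpe, hpX⟩ :=
    h.exists_path_avoiding_edge hG hY (heX a (by simp)) (heX b (by simp)) hab
  have hc := (Walk.cons_isCycle_iff p hab.symm).2 ⟨hp, by rwa [Sym2.eq_swap]⟩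
  obtain ⟨e', he', hne, he'D⟩ := hD.exists_other _ _ hc s(a, b) (by simp [Sym2.eq_swap]) heD
  rw [Walk.edges_cons, List.mem_cons] at he'
  have he'p := he'.resolve_left (by rwa [Sym2.eq_swap])
  refine ⟨⟨e', p.edges_subset_edgeSet he'p⟩, fun hh => hne (congrArg Subtype.val hh), he'D,
    fun z hz => hpX z ?_⟩
  exact p.mem_support_of_mem_edges he'p hz

/-- A thin cut cannot contain edges inside both sides of a thin bond. -/
theorem IsThinBond.not_edges_in_both_sides (hG : IsKConnected G 3) {X : Set V}
    (h : IsThinBond G X) {D : Set (Sym2 V)} (hD : IsThinCut G D) (e e' : G.edgeSet)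
    (heD : (e : Sym2 V) ∈ D) (heX : ∀ z ∈ (e : Sym2 V), z ∈ X) (he'D : (e' : Sym2 V) ∈ D)
    (he'X : ∀ z ∈ (e' : Sym2 V), z ∈ Xᶜ) : False := by
  obtain ⟨a, b, hab⟩ : ∃ a b, (e : Sym2 V) = s(a, b) := by
    induction h : (e : Sym2 V) using Sym2.ind with | _ a b => exact ⟨a, b, rfl⟩
  obtain ⟨a', b', hab'⟩ : ∃ a b, (e' : Sym2 V) = s(a, b) := by
    induction h : (e' : Sym2 V) using Sym2.ind with | _ a b => exact ⟨a, b, rfl⟩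
  have haX : a ∈ X := heX a (by simp [hab])
  have ha'X : a' ∈ Xᶜ := he'X a' (by simp [hab'])
  obtain ⟨Z, hZ, -, -, hZD⟩ := hD.exists_bond hG (x₀ := a) (y₀ := b)
    (by rw [← SimpleGraph.mem_edgeSet, ← hab]; exact e.2) (hab ▸ heD)
  obtain ⟨x, hx, y, hy, hxy⟩ := (hZD _ e.2).1 heD
  obtain ⟨x', hx', y', hy', hxy'⟩ := (hZD _ e'.2).1 he'D
  have hends : ∀ z ∈ (e : Sym2 V), ∀ z' ∈ (e' : Sym2 V), z ≠ z' := fun z hz z' hz' hh =>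
    he'X z' hz' (hh ▸ heX z hz)
  obtain ⟨e₂, hne, he₂D, he₂X⟩ := h.exists_other_edge hG ⟨a', ha'X⟩ hD e heD heX
  obtain ⟨e₂', hne', he₂'D, he₂'X⟩ :=
    h.compl.exists_other_edge hG ⟨a, by simpa using haX⟩ hD e' he'D he'X
  have hdiff : ∀ f f' : G.edgeSet, (∀ z ∈ (f : Sym2 V), z ∈ X) →
      (∀ z ∈ (f' : Sym2 V), z ∈ Xᶜ) → f ≠ f' := by
    rintro f f' hf hf' rfl
    induction hh : (f : Sym2 V) using Sym2.ind with | _ a b =>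
    exact hf' a (by simp [hh]) (hf a (by simp [hh]))
  -- The disjoint edges `e` and `e'` both cross `Z`, so each side of `Z` has two vertices.
  refine hZ.not_four_edges hG
    ⟨x, hx, x', hx', hends x (by simp [hxy]) x' (by simp [hxy'])⟩
    ⟨y, hy, y', hy', hends y (by simp [hxy]) y' (by simp [hxy'])⟩
    ![e, e₂, e', e₂'] ?_ ?_
  · have h1 := hdiff _ _ heX he'X
    have h2 := hdiff _ _ heX he₂'X
    have h3 := hdiff _ _ he₂X he'X
    have h4 := hdiff _ _ he₂X he₂'X
    intro i j hij
    fin_cases i <;> fin_cases j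
    exacts [rfl, absurd hij hne.symm, absurd hij h1, absurd hij h2, absurd hij hne, rfl,
      absurd hij h3, absurd hij h4, absurd hij.symm h1, absurd hij.symm h3, rfl,
      absurd hij hne'.symm, absurd hij.symm h2, absurd hij.symm h4, absurd hij hne', rfl]
  · intro i
    fin_cases i
    exacts [(hZD _ e.2).1 heD, (hZD _ e₂.2).1 he₂D, (hZD _ e'.2).1 he'D, (hZD _ e₂'.2).1 he₂'D]

/-! ### Circuits at a vertex, and transitions along a walk. -/

/-- The edges of a circuit at one of its vertices `w`: there are two of them, and the others form a
walk between their other ends. -/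
theorem exists_walk_of_isCycle {v w : V} {c : G.Walk v v} (hc : c.IsCycle) (hw : w ∈ c.support) :
    ∃ a b, ∃ q : G.Walk a b, a ≠ b ∧ s(w, a) ∈ c.edges ∧ s(w, b) ∈ c.edges ∧
      (∀ e ∈ c.edges, e = s(w, a) ∨ e = s(w, b) ∨ e ∈ q.edges) ∧
      ∀ e ∈ q.edges, e ∈ c.edges ∧ w ∉ e := by
  classical
  have hrot : (c.rotate w hw).IsCycle := hc.rotate hw
  have hmem : ∀ e, e ∈ (c.rotate w hw).edges ↔ e ∈ c.edges := fun e =>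
    (c.rotate_edges w hw).mem_iff
  generalize c.rotate w hw = c' at hrot hmem
  simp only [← hmem]
  cases c' with
  | nil => exact absurd rfl hrot.ne_nil
  | @cons _ a _ hwa p =>
    obtain ⟨hp, hwap⟩ := (Walk.cons_isCycle_iff p hwa).1 hrot
    have hp' := hp.reverse
    have hedges : ∀ e, e ∈ p.edges ↔ e ∈ p.reverse.edges := fun e => by simp
    generalize p.reverse = p' at hp' hedges
    cases p' with
    | nil => exact absurd rfl hwa.ne
    | @cons _ b _ hwb q =>
      obtain ⟨hq, hwq⟩ := (Walk.cons_isPath_iff hwb q).1 hp'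
      have hqe : ∀ e ∈ q.edges, w ∉ e := fun e he hwe => hwq (q.mem_support_of_mem_edges he hwe)
      refine ⟨b, a, q, ?_, ?_, ?_, ?_, ?_⟩
      · rintro rfl
        exact hwap ((hedges _).2 (by simp))
      all_goals simp only [Walk.edges_cons, List.mem_cons, hedges]
      · simp
      · simp
      · tauto
      · exact fun e he => ⟨Or.inr (Or.inr he), hqe e he⟩

/-- A walk with both edges in `R` and edges outside `R` has a vertex incident with both. -/
theorem exists_transition {a b : V} (q : G.Walk a b) {R : Set (Sym2 V)} {e e' : Sym2 V}
    (he : e ∈ q.edges) (heR : e ∈ R) (he' : e' ∈ q.edges) (he'R : e' ∉ R) :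
    ∃ z, ∃ d ∈ q.edges, ∃ d' ∈ q.edges, d ∈ R ∧ d' ∉ R ∧ z ∈ d ∧ z ∈ d' := by
  by_contra! hcon
  have key : ∀ {a b : V} (q : G.Walk a b) (S : Set (Sym2 V)),
      (∀ z, ∀ d ∈ q.edges, ∀ d' ∈ q.edges, d ∈ S → z ∈ d → z ∈ d' → d' ∈ S) →
      ∀ d ∈ q.edges, (a ∈ d → d ∈ S → ∀ d' ∈ q.edges, d' ∈ S) := by
    intro a b q S hS
    induction q with
    | nil => simp
    | @cons u v w huv q ih =>
      intro d hd had hdS d' hd'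
      have h1 : s(u, v) ∈ S := hS u d hd _ (by simp) hdS had (by simp)
      rw [Walk.edges_cons, List.mem_cons] at hd'
      rcases hd' with rfl | hd'
      · exact h1
      cases q with
      | nil => simp at hd'
      | @cons _ x _ hvx q =>
        refine ih (fun z d hd d' hd' => hS z d (List.mem_cons_of_mem _ hd) d'
          (List.mem_cons_of_mem _ hd')) s(v, x) (by simp) (by simp) ?_ d' hd'
        exact hS v s(u, v) (by simp) s(v, x) (by simp) h1 (by simp) (by simp)
  cases q with
  | nil => simp at he
  | @cons _ v _ hav q =>
    by_cases hf : s(a, v) ∈ R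
    · refine he'R (key _ R (fun z d hd d' hd' hdR hzd hzd' => ?_) s(a, v) (by simp) (by simp) hf
        e' he')
      by_contra hd'R
      exact hcon z d hd d' hd' hdR hd'R hzd hzd'
    · refine key _ Rᶜ (fun z d hd d' hd' hdR hzd hzd' hd'R => ?_) s(a, v) (by simp) (by simp) hf
        e he heR
      exact hcon z d' hd' d hd hd'R hdR hzd' hzd

/-! ### Preimages of vertex stars. -/

/-- The edges of `G` whose image under `f` is incident with `w`. -/
def starPreimage (f : G.edgeSet → G'.edgeSet) (w : W) : Set (Sym2 V) :=
  {e | ∃ he : e ∈ G.edgeSet, w ∈ (f ⟨e, he⟩ : Sym2 W)}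

theorem mem_starPreimage {f : G.edgeSet → G'.edgeSet} {w : W} (e : G.edgeSet) :
    (e : Sym2 V) ∈ starPreimage f w ↔ w ∈ (f e : Sym2 W) :=
  ⟨fun ⟨_, h⟩ => h, fun h => ⟨e.2, h⟩⟩

namespace IsCircuitInjection

variable {f : G.edgeSet → G'.edgeSet}

theorem exists_cycle (hf : IsCircuitInjection G G' f) {v : V} {c : G.Walk v v} (hc : c.IsCycle) :
    ∃ (w : W) (c' : G'.Walk w w), c'.IsCycle ∧
      (∀ e : G.edgeSet, (e : Sym2 V) ∈ c.edges → (f e : Sym2 W) ∈ c'.edges) ∧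
      ∀ d ∈ c'.edges, ∃ e : G.edgeSet, (e : Sym2 V) ∈ c.edges ∧ (f e : Sym2 W) = d := by
  obtain ⟨w, c', hc', h⟩ := hf.2 {e | (e : Sym2 V) ∈ c.edges} ⟨v, c, hc, fun e => Iff.rfl⟩
  refine ⟨w, c', hc', fun e he => (h _).1 ⟨e, he, rfl⟩, fun d hd => ?_⟩
  obtain ⟨e, he, hed⟩ := (h ⟨d, c'.edges_subset_edgeSet hd⟩).2 hd
  exact ⟨e, he, congrArg Subtype.val hed⟩

/-- The image circuit has exactly two edges at any vertex it visits, and injectivity of `f` carries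
this count back to `G`. -/
theorem isThinCut_starPreimage (hf : IsCircuitInjection G G' f) (w : W) :
    IsThinCut G (starPreimage f w) where
  exists_other := by
    rintro v c hc e he ⟨heG, hwe⟩
    obtain ⟨w', c', hc', hcc', hc'c⟩ := hf.exists_cycle hc
    have hfe := hcc' ⟨e, heG⟩ he
    obtain ⟨a, b, q, hab, ha, hb, -, -⟩ :=
      exists_walk_of_isCycle hc' (c'.mem_support_of_mem_edges hfe hwe)
    have hex : ∃ d ∈ c'.edges, w ∈ d ∧ d ≠ f ⟨e, heG⟩ := by
      by_cases h : s(w, a) = f ⟨e, heG⟩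
      · exact ⟨s(w, b), hb, by simp, fun hh => hab (Sym2.congr_right.1 (h.trans hh.symm))⟩
      · exact ⟨s(w, a), ha, by simp, h⟩
    obtain ⟨d, hd, hwd, hne⟩ := hex
    obtain ⟨e', he', rfl⟩ := hc'c d hd
    exact ⟨e', he', fun hh => hne (by congr; exact Subtype.ext hh), (mem_starPreimage e').2 hwd⟩
  atMostTwo := by
    rintro v c hc e₁ h₁ e₂ h₂ e₃ h₃ ⟨hG₁, hw₁⟩ ⟨hG₂, hw₂⟩ ⟨hG₃, hw₃⟩ h₁₂ h₁₃ h₂₃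
    obtain ⟨w', c', hc', hcc', -⟩ := hf.exists_cycle hc
    obtain ⟨a, b, q, -, -, -, hcov, hq⟩ :=
      exists_walk_of_isCycle hc' (c'.mem_support_of_mem_edges (hcc' ⟨e₁, hG₁⟩ h₁) hw₁)
    have key : ∀ (e : G.edgeSet), (e : Sym2 V) ∈ c.edges → w ∈ (f e : Sym2 W) →
        (f e : Sym2 W) = s(w, a) ∨ (f e : Sym2 W) = s(w, b) := fun e he hwe => by
      rcases hcov _ (hcc' e he) with h | h | h
      exacts [Or.inl h, Or.inr h, absurd hwe (hq _ h).2]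
    have inj : ∀ {e e' : Sym2 V} (he : e ∈ G.edgeSet) (he' : e' ∈ G.edgeSet) {d : Sym2 W},
        (f ⟨e, he⟩ : Sym2 W) = d → (f ⟨e', he'⟩ : Sym2 W) = d → e = e' := by
      intro e e' he he' d h h'
      exact congrArg Subtype.val (hf.1 (Subtype.ext (h.trans h'.symm)))
    rcases key ⟨e₁, hG₁⟩ h₁ hw₁ with k₁ | k₁ <;> rcases key ⟨e₂, hG₂⟩ h₂ hw₂ with k₂ | k₂ <;>
      rcases key ⟨e₃, hG₃⟩ h₃ hw₃ with k₃ | k₃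
    all_goals first
      | exact h₁₂ (inj _ _ k₁ k₂)
      | exact h₁₃ (inj _ _ k₁ k₃)
      | exact h₂₃ (inj _ _ k₂ k₃)

/-- The preimage of a vertex star is not a thin bond with two nontrivial sides. -/
theorem subsingleton_side (hG : IsKConnected G 3) (hf : IsCircuitInjection G G' f) {w : W}
    {X : Set V} (hX : IsThinBond G X) {x₀ y₀ : V} (h₀ : G.Adj x₀ y₀) (hx₀ : x₀ ∈ X) (hy₀ : y₀ ∈ Xᶜ)
    (hbd : ∀ e ∈ G.edgeSet, e ∈ starPreimage f w ↔ e ∈ boundary X) :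
    X.Subsingleton ∨ Xᶜ.Subsingleton := by
  by_contra! hcon
  obtain ⟨hXn, hYn⟩ := hcon
  -- Otherwise `x₀` alone would separate the rest of `X` from `y₀`.
  obtain ⟨x₁, hx₁, hx₁₀, y₁, hy₁, h₁⟩ : ∃ x₁ ∈ X, x₁ ≠ x₀ ∧ ∃ y₁ ∈ Xᶜ, G.Adj x₁ y₁ := by
    by_contra! hno
    obtain ⟨u, hu, hux⟩ := hXn.exists_ne x₀
    refine hy₀ ((hG.reachableIn (s := x₀) (t := x₀) (u := u) (v := y₀) (by simpa using hux)
      (by simpa using h₀.ne')).mem_of_closed (T := X \ {x₀}) ⟨hu, hux⟩ ?_).1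
    rintro t ⟨ht, htx⟩ t' ht' hadj
    exact ⟨by_contra fun h => hno t ht htx t' h hadj, by simpa using ht'⟩
  have hy₁₀ : y₁ ≠ y₀ := by
    rintro rfl
    exact hx₁₀ (hX.compl.eq_of_adj_of_adj hG hYn hy₁ (by simpa using hx₁) (by simpa using hx₀)
      h₁.symm h₀.symm)
  obtain ⟨p, hp, hpX⟩ := (hX.conn x₀ hx₀ x₁ hx₁).exists_isPath
  obtain ⟨q, hq, hqX⟩ := (hX.conn_compl y₁ hy₁ y₀ hy₀).exists_isPath
  have hpath := isPath_append_cons hp hq h₁ fun x hx hx' => hqX x hx' (hpX x hx)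
  have hc := (Walk.cons_isCycle_iff _ h₀.symm).2 ⟨hpath, fun hh => by
    have := hpath.length_eq_one_of_mem_edges (Sym2.eq_swap ▸ hh)
    rw [Walk.length_append, Walk.length_cons] at this
    have : p.length = 0 := by omega
    exact hx₁₀ (Walk.eq_of_length_eq_zero this).symm⟩
  obtain ⟨w', c', hc', hcc', hc'c⟩ := hf.exists_cycle hc
  simp only [Walk.edges_cons, Walk.edges_append, List.mem_cons, List.mem_append] at hcc' hc'c
  have hw₀ : w ∈ (f ⟨s(x₀, y₀), h₀⟩ : Sym2 W) :=
    (mem_starPreimage _).1 ((hbd _ h₀).2 ⟨_, hx₀, _, hy₀, rfl⟩)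
  have hw₁ : w ∈ (f ⟨s(x₁, y₁), h₁⟩ : Sym2 W) :=
    (mem_starPreimage _).1 ((hbd _ h₁).2 ⟨_, hx₁, _, hy₁, rfl⟩)
  obtain ⟨a, b, r, -, -, -, hcov, hr⟩ := exists_walk_of_isCycle hc'
    (c'.mem_support_of_mem_edges (hcc' ⟨s(x₀, y₀), h₀⟩ (Or.inl Sym2.eq_swap)) hw₀)
  have hpin : ∀ e : G.edgeSet, (e : Sym2 V) ∈ p.edges → ∀ z ∈ (e : Sym2 V), z ∈ X :=
    fun e he z hz => hpX z (p.mem_support_of_mem_edges he hz)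
  have hqin : ∀ e : G.edgeSet, (e : Sym2 V) ∈ q.edges → ∀ z ∈ (e : Sym2 V), z ∈ Xᶜ :=
    fun e he z hz => hqX z (q.mem_support_of_mem_edges he hz)
  -- Edges of `p` and `q` do not cross the boundary of `X`, so their images miss `w` and lie on `r`.
  have hoff : ∀ e : G.edgeSet, ((e : Sym2 V) ∈ p.edges ∨ (e : Sym2 V) ∈ q.edges) →
      (f e : Sym2 W) ∈ r.edges := by
    intro e he
    have hwe : w ∉ (f e : Sym2 W) := by
      intro hwe
      obtain ⟨x, hx, y, hy, hxy⟩ := (hbd _ e.2).1 ((mem_starPreimage e).2 hwe)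
      rcases he with he | he
      · exact hy (hpin e he y (by simp [hxy]))
      · exact hqin e he x (by simp [hxy]) hx
    rcases hcov _ (hcc' e (by tauto)) with h | h | h
    · exact absurd (h ▸ Sym2.mem_mk_left w a) hwe
    · exact absurd (h ▸ Sym2.mem_mk_left w b) hwe
    · exact h
  have hedge : ∀ {a b : V} (p : G.Walk a b), a ≠ b → ∃ e : G.edgeSet, (e : Sym2 V) ∈ p.edges := by
    intro a b p hab
    cases p with
    | nil => exact absurd rfl hab
    | @cons _ c _ h p => exact ⟨⟨s(a, c), h⟩, by simp⟩
  obtain ⟨g, hg⟩ := hedge p hx₁₀.symm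
  obtain ⟨k, hk⟩ := hedge q hy₁₀
  obtain ⟨z, d, hd, d', hd', ⟨e, he, hed⟩, hd'R, hzd, hzd'⟩ := exists_transition r
    (R := {d | ∃ e : G.edgeSet, (e : Sym2 V) ∈ p.edges ∧ (f e : Sym2 W) = d})
    (hoff g (Or.inl hg)) ⟨g, hg, rfl⟩ (hoff k (Or.inr hk)) (by
      rintro ⟨e, he, hed⟩
      obtain rfl := hf.1 (Subtype.ext hed)
      obtain ⟨a, ha⟩ : ∃ a, a ∈ (e : Sym2 V) := ⟨_, Sym2.out_fst_mem _⟩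
      exact hqin e hk a ha (hpin e he a ha))
  obtain ⟨hd'c, hwd'⟩ := hr d' hd'
  obtain ⟨e', he', hed'⟩ := hc'c d' hd'c
  -- The two crossing edges have images at `w`, which `r` avoids.
  have he'q : (e' : Sym2 V) ∈ q.edges := by
    rcases he' with h | h | h | h
    · refine absurd ?_ hwd'
      rw [← hed', show e' = ⟨s(x₀, y₀), h₀⟩ from Subtype.ext (h.trans Sym2.eq_swap)]
      exact hw₀
    · exact absurd ⟨e', h, hed'⟩ hd'R
    · refine absurd ?_ hwd'
      rw [← hed', show e' = ⟨s(x₁, y₁), h₁⟩ from Subtype.ext h]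
      exact hw₁
    · exact h
  exact hX.not_edges_in_both_sides hG (hf.isThinCut_starPreimage z) e e'
    ((mem_starPreimage e).2 (hed ▸ hzd)) (hpin e he) ((mem_starPreimage e').2 (hed' ▸ hzd'))
    (hqin e' he'q)

/-- The preimage of a vertex star is a vertex star. -/
theorem exists_center (hG : IsKConnected G 3) (hf : IsCircuitInjection G G' f) {w : W}
    (hw : ∃ e : G.edgeSet, w ∈ (f e : Sym2 W)) :
    ∃ v, ∀ e : G.edgeSet, w ∈ (f e : Sym2 W) ↔ v ∈ (e : Sym2 V) := by
  obtain ⟨⟨e, he⟩, hwe⟩ := hw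
  induction e using Sym2.ind with | _ x₀ y₀ =>
  obtain ⟨X, hX, hx₀, hy₀, hbd⟩ := (hf.isThinCut_starPreimage w).exists_bond hG he
    ((mem_starPreimage ⟨s(x₀, y₀), he⟩).2 hwe)
  have key : ∀ (Z : Set V) (v : V), v ∈ Z → Z.Subsingleton →
      ∀ e ∈ G.edgeSet, (e ∈ boundary Z ↔ v ∈ e) := by
    intro Z v hv hZ e he
    constructor
    · rintro ⟨x, hx, y, hy, rfl⟩
      simp [hZ hv hx]
    · intro hve
      obtain ⟨y, rfl⟩ := Sym2.mem_iff_exists.1 hve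
      exact ⟨v, hv, y, fun hy => (G.ne_of_adj he) (hZ hv hy), rfl⟩
  rcases hf.subsingleton_side hG hX he hx₀ hy₀ hbd with h | h
  · exact ⟨x₀, fun e => by rw [← mem_starPreimage, hbd _ e.2, key X x₀ hx₀ h _ e.2]⟩
  · exact ⟨y₀, fun e => by
      rw [← mem_starPreimage, hbd _ e.2, ← boundary_compl, key Xᶜ y₀ hy₀ h _ e.2]⟩

end IsCircuitInjection

end CircuitInjection

/-! ### The vertex isomorphism. -/

theorem theorem6 {V W : Type*} (G : SimpleGraph V) (G' : SimpleGraph W)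
    (hG : CircuitInjection.IsKConnected G 3)
    (hG' : ∀ w : W, ¬ G'.IsIsolated w)
    (f : G.edgeSet → G'.edgeSet)
    (hf : CircuitInjection.IsCircuitInjection G G' f)
    (hf_onto : Function.Surjective f) :
    CircuitInjection.IsInducedByVertexIso G G' f := by
  have hex : ∀ w, ∃ e : G.edgeSet, w ∈ (f e : Sym2 W) := by
    intro w
    obtain ⟨w', hw'⟩ : ∃ w', G'.Adj w w' := by
      simpa [SimpleGraph.IsIsolated] using hG' w
    obtain ⟨e, he⟩ := hf_onto ⟨s(w, w'), hw'⟩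
    exact ⟨e, by simp [he]⟩
  choose ψ hψ using fun w => hf.exists_center hG (hex w)
  have hinj : Function.Injective ψ := by
    intro w w' h
    by_contra hne
    -- If `ψ w = ψ w'`, every edge at this vertex is sent to `ww'`, yet there are two such edges.
    -- The vertex `d` only meets the side conditions of `exists_adj_ne`.
    obtain ⟨d, hd, -, -⟩ := hG.exists_ne (ψ w) (ψ w) (ψ w)
    obtain ⟨u, hu, -⟩ := hG.exists_adj_ne hd.symm hd.symm
    obtain ⟨u', hu', huu', -⟩ := hG.exists_adj_ne hu.ne hu.ne
    have hval : ∀ t (ht : G.Adj (ψ w) t), (f ⟨s(ψ w, t), ht⟩ : Sym2 W) = s(w, w') :=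
      fun t ht => (Sym2.mem_and_mem_iff hne).1
        ⟨(hψ w _).2 (by simp), (hψ w' _).2 (by simp [h])⟩
    have := hf.1 (Subtype.ext ((hval u hu).trans (hval u' hu').symm))
    exact huu' (Sym2.congr_right.1 (congrArg Subtype.val this)).symm
  have hmap : ∀ e : G.edgeSet, (e : Sym2 V) = Sym2.map ψ (f e) := by
    intro e
    induction h : (f e : Sym2 W) using Sym2.ind with | _ w w' =>
    have hww' : G'.Adj w w' := by
      rw [← SimpleGraph.mem_edgeSet, ← h]; exact (f e).2
    rw [Sym2.map_mk]
    exact (Sym2.mem_and_mem_iff (hinj.ne hww'.ne)).1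
      ⟨(hψ w e).1 (by simp [h]), (hψ w' e).1 (by simp [h])⟩
  have hsurj : Function.Surjective ψ := by
    intro v
    obtain ⟨d, hd, -, -⟩ := hG.exists_ne v v v
    obtain ⟨u, hu, -⟩ := hG.exists_adj_ne hd.symm hd.symm
    have hv : v ∈ Sym2.map ψ (f ⟨s(v, u), hu⟩) := by
      rw [← hmap]; simp
    obtain ⟨w, -, hw⟩ := Sym2.mem_map.1 hv
    exact ⟨w, hw⟩
  let Ψ : W ≃ V := Equiv.ofBijective ψ ⟨hinj, hsurj⟩
  have hΨ : ∀ w, Ψ w = ψ w := fun _ => rfl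
  let φ : G' ≃g G := ⟨Ψ, by
    intro w w'
    rw [hΨ, hΨ]
    constructor
    · intro hadj
      have := hmap ⟨s(ψ w, ψ w'), hadj⟩
      have h2 : s(w, w') = (f ⟨s(ψ w, ψ w'), hadj⟩ : Sym2 W) :=
        Sym2.map.injective hinj (by rw [Sym2.map_mk]; exact this)
      rw [← SimpleGraph.mem_edgeSet, h2]
      exact (f _).2
    · intro hadj
      obtain ⟨e, he⟩ := hf_onto ⟨s(w, w'), hadj⟩
      have := hmap e
      rw [he, Sym2.map_mk] at this
      rw [← SimpleGraph.mem_edgeSet, ← this]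
      exact e.2⟩
  refine ⟨φ.symm, fun e => Sym2.map.injective hinj ?_⟩
  rw [← hmap, Sym2.map_map]
  have : ψ ∘ φ.symm = id := by
    funext v
    exact φ.apply_symm_apply v
  rw [this, Sym2.map_id, id]
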